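/- All monoids are commutative and written additively. Let $\mathcal A$ be a skeletally small abelian category. A Serre subcategory of $\mathcal A$ is a full subcategory $\mathcal S$ containing $0$ such that, for every short exact sequence $0\to X\to Y\to Z\to 0$ in $\mathcal A$, one has $Y\in\mathcal S$ if and only if $X,Z\in\mathcal S$. Let $\mathrm{Serre}(\mathcal A)$ be the set of Serre subcategories, with the topology whose closed subsets are the sets $\{\mathcal S\mid \mathcal S\cap\mathcal X=\emptyset\}$ for classes $\mathcal X$ of objects. For $X\in\mathcal A$ let $\langle X\rangle$ be the smallest Serre subcategory containing $X$, and put $U_X=\{\mathcal S\mid X\in\mathcal S\}$; the sets $U_X$ form an open basis. Let $\mathrm M(\mathcal A)$ be the Grothendieck monoid of $\mathcal A$: the commutative monoid generated by symbols $[X]$, $X\in\mathcal A$, subject to $[0]=0$ and $[Y]=[X]+[Z]$ for every short exact sequence $0\to X\to Y\to Z\to 0$. An exact functor $F$ induces a homomorphism $[X]\mapsto[FX]$. Let $\mathcal M_{\mathcal A}$ be the sheaf of monoids on $\mathrm{Serre}(\mathcal A)$ given by $$\mathcal M_{\mathcal A}(V)=\varprojlim_{U_X\subseteq V}\mathrm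 M(\mathcal A/\langle X\rangle),$$ where $\mathcal A/\langle X\rangle$ is the abelian quotient category and the transition maps are induced by the canonical exact functors $\mathcal A/\langle X\rangle\to\mathcal A/\langle Y\rangle$ for $U_Y\subseteq U_X$ (equivalently, $\langle X\rangle\subseteq\langle Y\rangle$). For a monoid $M$, a prime ideal is a subset $\mathfrak p\subsetneq M$ (possibly empty) with $\mathfrak p+M\subseteq\mathfrak p$ such that $x+y\in\mathfrak p$ implies $x\in\mathfrak p$ or $y\in\mathfrak p$. Let $\mathrm{MSpec}\,M$ be the set of prime ideals, with the topology whose closed subsets are the sets $\{\mathfrak p\mid S\subseteq\mathfrak p\}$ for $S\subseteq M$. Let $\mathcal O_M$ be its structure sheaf, $\mathcal O_M(V)=\varprojlim_{D(f)\subseteq V}M_f$, where $D(f)=\{\mathfrak p\mid f\notin\mathfrak p\}$ and $M_f$ is the localization of $M$ at $f$, and let $\overline{\mathcal O}_M$ be the sheafification of the presheaf $V\mapsto\mathcal O_M(V)/\mathcal O_M(V)^\times$, the quotient by the submonoid of units. A monoidal space is a topological space with a sheaf of monoids. A morphism $(X,\mathcal M)\to(Y,\mathcal N)$ of monoidal spaces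 is a continuous map $f\colon X\to Y$ with a morphism of sheaves $f^{-1}\mathcal N\to\mathcal M$ whose stalk maps $\varphi\colon \mathcal N_{f(x)}\to\mathcal M_x$ are local, that is, an element is a unit whenever its image under $\varphi$ is. **Proposition.** The map $$\Phi\colon\mathrm{Serre}(\mathcal A)\to\mathrm{MSpec}\,\mathrm M(\mathcal A),\qquad \mathcal S\mapsto \mathrm M(\mathcal A)\setminus\{[X]\mid X\in\mathcal S\},$$ is a bijection, and it is the underlying map of an isomorphism of monoidal spaces $$(\mathrm{Serre}(\mathcal A),\mathcal M_{\mathcal A})\;\cong\;(\mathrm{MSpec}\,\mathrm M(\mathcal A),\overline{\mathcal O}_{\mathrm M(\mathcal A)})$$ whose sheaf component is the natural one: for every $Y\in\mathcal A$ it takes the global section of $\overline{\mathcal O}_{\mathrm M(\mathcal A)}$ defined by $[Y]\in\mathrm M(\mathcal A)$ to the global section of $\mathcal M_{\mathcal A}$ whose component in $\mathrm M(\mathcal A/\langle X\rangle)$ is the class of the image of $Y$ in $\mathcal A/\langle X\rangle$, for all $X\in\mathcal A$. -/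

import Mathlib

open CategoryTheory Limits TopologicalSpace Opposite AlgebraicGeometry

open scoped ZeroObject

universe v u

noncomputable section

/-! ## Colimits of commutative monoids (needed for stalks and sheafification) -/

namespace AddCommMonCat

variable {J : Type u} [SmallCategory J] (F : J ⥤ AddCommMonCat.{u})

open Classical in
/-- The congruence on the direct sum of the `F j` identifying `a` with `F f a`. -/
def colimitCon : AddCon (DirectSum J fun j => F.obj j) :=
  addConGen fun x y => ∃ (i j : J) (f : i ⟶ j) (a : F.obj i),
    x = DirectSum.of (fun j => F.obj j) i a ∧ y = DirectSum.of (fun j => F.obj j) j (F.map f a)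

open Classical in
/-- The colimit cocone of a diagram of commutative monoids. -/
def colimitCocone : Cocone F where
  pt := AddCommMonCat.of (colimitCon F).Quotient
  ι :=
    { app := fun j => AddCommMonCat.ofHom
        ((colimitCon F).mk'.comp (DirectSum.of (fun j => F.obj j) j))
      naturality := fun i j f => by
        ext a
        exact ((AddCon.eq _).2 (AddConGen.Rel.of _ _ ⟨i, j, f, a, rfl, rfl⟩)).symm }

open Classical in
/-- `colimitCocone` is a colimit. -/
def isColimitColimitCocone : IsColimit (colimitCocone F) where
  desc s := AddCommMonCat.ofHom
    ((colimitCon F).lift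
      (DirectSum.toAddMonoid (β := fun j => F.obj j) fun j => (s.ι.app j).hom) (by
      refine AddCon.addConGen_le.2 ?_
      rintro _ _ ⟨i, j, f, a, rfl, rfl⟩
      have := ConcreteCategory.congr_hom (s.w f) a
      simpa only [AddCon.ker_rel, DirectSum.toAddMonoid_of] using! this.symm))
  fac s j := by
    ext a
    exact DirectSum.toAddMonoid_of (β := fun j => F.obj j) (γ := s.pt)
      (fun j => (s.ι.app j).hom) j a
  uniq s m hm := by
    ext x
    obtain ⟨x, rfl⟩ := AddCon.mk'_surjective x
    change (m.hom.comp (colimitCon F).mk') x =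
      DirectSum.toAddMonoid (β := fun j => F.obj j) (fun j => (s.ι.app j).hom) x
    refine DFunLike.congr_fun (DirectSum.addHom_ext fun j a => ?_) x
    rw [DirectSum.toAddMonoid_of]
    exact ConcreteCategory.congr_hom (hm j) a

instance : HasColimits AddCommMonCat.{u} :=
  ⟨fun _ _ => ⟨fun F => ⟨⟨⟨_, isColimitColimitCocone F⟩⟩⟩⟩⟩

end AddCommMonCat

/-! ## Monoidal spaces -/

/-- A monoidal space: a topological space with a sheaf of commutative (additive) monoids. -/
structure MonoidalSpace extends SheafedSpace.{_, _, u} AddCommMonCat.{u}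

namespace MonoidalSpace

/-- A homomorphism `φ : M →+ N` of commutative monoids is local if `φ⁻¹(Nˣ) = Mˣ`. -/
def IsLocalAddHom {M N : Type*} [AddCommMonoid M] [AddCommMonoid N] (φ : M →+ N) : Prop :=
  ∀ x : M, IsAddUnit (φ x) ↔ IsAddUnit x

/-- A morphism of monoidal spaces: a continuous map `f : X → Y` with a morphism of sheaves
`𝒪_Y ⟶ f_* 𝒪_X` (equivalently `f⁻¹ 𝒪_Y ⟶ 𝒪_X`) inducing local homomorphisms on stalks. -/
structure Hom (X Y : MonoidalSpace.{u}) : Type u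
    extends X.toPresheafedSpace.Hom Y.toPresheafedSpace where
  isLocal : ∀ x, IsLocalAddHom (toHom.stalkMap x).hom

@[ext]
lemma Hom.ext' {X Y : MonoidalSpace.{u}} {f g : Hom X Y} (h : f.toHom = g.toHom) : f = g := by
  cases f; cases g; congr

instance : Category MonoidalSpace.{u} where
  Hom := Hom
  id X := ⟨𝟙 X.toPresheafedSpace, fun x y => by
    rw [PresheafedSpace.stalkMap.id]; rfl⟩
  comp {X Y Z} f g := ⟨(f.toHom ≫ g.toHom : X.toPresheafedSpace ⟶ Z.toPresheafedSpace),
    fun x y => by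
      rw [PresheafedSpace.stalkMap.comp]
      exact (f.isLocal x _).trans (g.isLocal _ y)⟩

end MonoidalSpace

/-! ## Sheaves defined on a basis of strongly quasi-compact open subsets -/

/-- A presheaf of commutative monoids on a basis `{B i}` of strongly quasi-compact open subsets
(every open covering of `B i` has a member containing `B i`). The basis is indexed by a type `I`,
possibly with repetitions; by `res_refl` and `res_res`, `obj i` depends only on the
open set `B i`, up to the canonical isomorphism. -/
structure BasisPresheaf (X : TopCat.{u}) where
  /-- the index type of the basis -/
  I : Type u
  /-- the basic open sets -/
  B : I → Opens X
  isBasis : Opens.IsBasis (Set.range B)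
  stronglyQuasiCompact : ∀ (i : I) {κ : Type u} (V : κ → Opens X),
    B i ≤ iSup V → ∃ k, B i ≤ V k
  /-- the sections over a basic open set -/
  obj : I → AddCommMonCat.{u}
  /-- the restriction maps between basic open sets -/
  res : ∀ {i j : I}, B j ≤ B i → (obj i →+ obj j)
  res_refl : ∀ (i : I) (x : obj i), res (le_refl (B i)) x = x
  res_res : ∀ {i j k : I} (h : B j ≤ B i) (h' : B k ≤ B j) (x : obj i),
    res h' (res h x) = res (h'.trans h) x

namespace BasisPresheaf

variable {X : TopCat.{u}} (F : BasisPresheaf X)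

/-- The limit of `F i` over all basic open sets `B i ⊆ V`: compatible families. -/
def sections (V : Opens X) : AddSubmonoid (∀ i : {i : F.I // F.B i ≤ V}, F.obj i.1) where
  carrier := {s | ∀ (i j : {i : F.I // F.B i ≤ V}) (h : F.B j.1 ≤ F.B i.1), F.res h (s i) = s j}
  zero_mem' := fun _ _ _ => map_zero _
  add_mem' := fun {s t} hs ht i j h => by
    rw [Pi.add_apply, Pi.add_apply, map_add, hs i j h, ht i j h]

/-- The component at the basic open set `B i ⊆ V` of a section over `V`. -/
def eval {V : Opens X} (i : F.I) (h : F.B i ≤ V) : F.sections V →+ F.obj i where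
  toFun s := s.1 ⟨i, h⟩
  map_zero' := rfl
  map_add' _ _ := rfl

lemma sections_ext {V : Opens X} {s t : F.sections V}
    (h : ∀ i (hi : F.B i ≤ V), F.eval i hi s = F.eval i hi t) : s = t :=
  Subtype.ext (funext fun i => h i.1 i.2)

/-- The sections over a basic open set `B i` are `F i`. -/
lemma eval_bijective (i : F.I) : Function.Bijective (F.eval i (le_refl (F.B i))) := by
  refine ⟨fun s t hst => F.sections_ext fun j hj => ?_, fun x => ?_⟩
  · have hs := s.2 ⟨i, le_refl _⟩ ⟨j, hj⟩ hj
    have ht := t.2 ⟨i, le_refl _⟩ ⟨j, hj⟩ hj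
    exact hs.symm.trans ((congrArg (F.res hj) hst).trans ht)
  · exact ⟨⟨fun j => F.res j.2 x, fun j k h => F.res_res j.2 h x⟩, F.res_refl i x⟩

/-- Restriction of sections to a smaller open subset. -/
def restrict {V W : Opens X} (h : W ≤ V) : F.sections V →+ F.sections W where
  toFun s := ⟨fun i => s.1 ⟨i.1, i.2.trans h⟩, fun i j hij => s.2 ⟨i.1, i.2.trans h⟩ ⟨j.1, j.2.trans h⟩ hij⟩
  map_zero' := rfl
  map_add' _ _ := rfl

/-- The presheaf `V ↦ lim_{B i ⊆ V} F i` on `X`. -/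
def presheaf : TopCat.Presheaf AddCommMonCat.{u} X where
  obj V := AddCommMonCat.of (F.sections V.unop)
  map f := AddCommMonCat.ofHom (F.restrict f.unop.le)
  map_id _ := rfl
  map_comp _ _ := rfl

lemma presheaf_isSheaf : F.presheaf.IsSheaf := by
  rw [TopCat.Presheaf.isSheaf_iff_isSheafUniqueGluing]
  intro κ V sf hsf
  have key : ∀ (i : F.I) (k l : κ) (hk : F.B i ≤ V k) (hl : F.B i ≤ V l),
      F.eval i hk (sf k) = F.eval i hl (sf l) := fun i k l hk hl =>
    congrArg (F.eval i (le_inf hk hl)) (hsf k l)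
  choose c hc using fun i : {i : F.I // F.B i ≤ iSup V} => F.stronglyQuasiCompact i.1 V i.2
  refine ⟨⟨fun i => F.eval i.1 (hc i) (sf (c i)), fun i j h => ?_⟩, fun k => ?_, fun t ht => ?_⟩
  · exact (Subtype.property (p := fun s => s ∈ F.sections (V (c i))) (sf (c i)) ⟨i.1, hc i⟩
      ⟨j.1, h.trans (hc i)⟩ h).trans (key j.1 (c i) (c j) (h.trans (hc i)) (hc j))
  · exact F.sections_ext fun i hi => key i _ k (hc ⟨i, hi.trans (le_iSup V k)⟩) hi
  · refine F.sections_ext fun i hi => ?_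
    exact congrArg (F.eval i (hc ⟨i, hi⟩)) (ht (c ⟨i, hi⟩))

/-- The global section given by a compatible family indexed by all basic open sets. -/
def globalSection (s : ∀ i, F.obj i) (hs : ∀ i j (h : F.B j ≤ F.B i), F.res h (s i) = s j) :
    F.sections ⊤ :=
  ⟨fun i => s i.1, fun i j h => hs i.1 j.1 h⟩

end BasisPresheaf

/-! ## The spectrum of a commutative monoid -/

/-- A prime ideal of a commutative monoid (written additively). The empty set is allowed. -/
@[ext]
structure MSpec (M : Type u) [AddCommMonoid M] where
  carrier : Set M
  add_mem : ∀ {x : M} (a : M), x ∈ carrier → x + a ∈ carrier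
  ne_univ : carrier ≠ Set.univ
  mem_or_mem : ∀ {x y : M}, x + y ∈ carrier → x ∈ carrier ∨ y ∈ carrier

namespace MSpec

variable {M : Type u} [AddCommMonoid M]

lemma zero_notMem (p : MSpec M) : (0 : M) ∉ p.carrier := fun h =>
  p.ne_univ (Set.eq_univ_of_forall fun x => by simpa using p.add_mem x h)

/-- `V(S)`, the set of prime ideals containing `S`. -/
def zeroLocus (S : Set M) : Set (MSpec M) := {p | S ⊆ p.carrier}

/-- The Zariski topology: the closed subsets are the `V(S)`. -/
instance : TopologicalSpace (MSpec M) :=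
  TopologicalSpace.ofClosed (Set.range zeroLocus)
    ⟨Set.univ, Set.eq_empty_of_forall_notMem fun p hp => p.zero_notMem (hp trivial)⟩
    (fun T hT => ⟨⋃₀ {S | zeroLocus S ∈ T}, by
      ext p
      simp only [zeroLocus, Set.mem_ofPred_eq, Set.sUnion_subset_iff, Set.mem_sInter]
      constructor
      · intro h Z hZ
        obtain ⟨S, rfl⟩ := hT hZ
        exact h S hZ
      · intro h S hS
        exact h _ hS⟩)
    (by
      rintro _ ⟨S, rfl⟩ _ ⟨T, rfl⟩
      refine ⟨{x | ∃ s ∈ S, ∃ t ∈ T, s + t = x}, ?_⟩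
      ext p
      constructor
      · intro h
        by_contra hp
        rw [Set.mem_union, not_or] at hp
        obtain ⟨s, hs, hs'⟩ := Set.not_subset.1 hp.1
        obtain ⟨t, ht, ht'⟩ := Set.not_subset.1 hp.2
        exact (p.mem_or_mem (h ⟨s, hs, t, ht, rfl⟩)).elim hs' ht'
      · rintro (h | h) _ ⟨s, hs, t, ht, rfl⟩
        · exact p.add_mem t (h hs)
        · rw [add_comm]; exact p.add_mem s (h ht))

lemma isClosed_iff {Z : Set (MSpec M)} : IsClosed Z ↔ ∃ S : Set M, zeroLocus S = Z := by
  rw [← isOpen_compl_iff]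
  change Zᶜᶜ ∈ _ ↔ _
  rw [compl_compl]; rfl

/-- The principal open subset `D(f) = {𝔭 | f ∉ 𝔭}`. -/
def basicOpen (f : M) : Opens (MSpec M) :=
  ⟨{p | f ∉ p.carrier}, by
    rw [← isClosed_compl_iff, isClosed_iff]
    exact ⟨{f}, by ext p; simp [zeroLocus]⟩⟩

lemma mem_basicOpen {f : M} {p : MSpec M} : p ∈ basicOpen f ↔ f ∉ p.carrier := Iff.rfl

lemma exists_of_mem_open {V : Opens (MSpec M)} {p : MSpec M} (hp : p ∈ V) :
    ∃ f : M, p ∈ basicOpen f ∧ basicOpen f ≤ V := by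
  obtain ⟨S, hS⟩ := isClosed_iff.1 V.isOpen.isClosed_compl
  have : p ∉ zeroLocus S := by rw [hS]; exact fun h => h hp
  obtain ⟨f, hf, hfp⟩ := Set.not_subset.1 this
  refine ⟨f, hfp, fun q hq => ?_⟩
  by_contra hqV
  have : q ∈ zeroLocus S := by rw [hS]; exact hqV
  exact hq (this hf)

/-- The complement of the face generated by `f`, the largest prime ideal in `D(f)`. -/
def maxPrime (f : M) : MSpec M where
  carrier := {x | ¬ ∃ (y : M) (n : ℕ), x + y = n • f}
  add_mem := fun a hx ⟨y, n, h⟩ => hx ⟨a + y, n, by rw [← h, add_assoc]⟩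
  ne_univ := fun h => (h.symm ▸ Set.mem_univ (0 : M) :
    (0 : M) ∈ {x | ¬ ∃ (y : M) (n : ℕ), x + y = n • f}) ⟨0, 0, by simp⟩
  mem_or_mem := fun {x y} h => by
    by_contra hc
    rw [not_or] at hc
    obtain ⟨⟨a, n, ha⟩, ⟨b, m, hb⟩⟩ := And.intro (not_not.1 hc.1) (not_not.1 hc.2)
    exact h ⟨a + b, n + m, by rw [add_nsmul, ← ha, ← hb, add_add_add_comm]⟩

lemma maxPrime_mem (f : M) : maxPrime f ∈ basicOpen f := fun h => h ⟨0, 1, by simp⟩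

lemma basicOpen_le_iff {f g : M} :
    basicOpen g ≤ basicOpen f ↔ ∃ (y : M) (n : ℕ), f + y = n • g := by
  constructor
  · intro h
    exact not_not.1 (h (maxPrime_mem g))
  · rintro ⟨y, n, h⟩ p hp hfp
    have h1 : n • g ∈ p.carrier := h ▸ p.add_mem y hfp
    clear h
    induction n with
    | zero => exact p.zero_notMem (by simpa using h1)
    | succ n ih =>
      rw [succ_nsmul] at h1
      exact (p.mem_or_mem h1).elim ih hp

lemma basicOpen_le_of_maxPrime_mem {f : M} {V : Opens (MSpec M)} (h : maxPrime f ∈ V) :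
    basicOpen f ≤ V := by
  obtain ⟨g, hg, hgV⟩ := exists_of_mem_open h
  exact (basicOpen_le_iff.2 (not_not.1 hg)).trans hgV

/-- The localization homomorphism `M → M_f`. -/
def toLoc (f : M) : M →+ AddLocalization (AddSubmonoid.multiples f) :=
  (AddLocalization.addMonoidOf (AddSubmonoid.multiples f)).toAddMonoidHom

/-- If `D(g) ⊆ D(f)`, then multiples of `f` become invertible in the localization `M_g`. -/
lemma isAddUnit_of_basicOpen_le {f g : M} (h : basicOpen g ≤ basicOpen f)
    (s : AddSubmonoid.multiples f) :
    IsAddUnit (toLoc g s) := by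
  obtain ⟨y, n, hy⟩ := basicOpen_le_iff.1 h
  obtain ⟨_, m, rfl⟩ := s
  have h1 : IsAddUnit (toLoc g (f + y)) := by
    rw [hy]
    exact (AddLocalization.addMonoidOf (AddSubmonoid.multiples g)).map_addUnits
      ⟨n • g, n, rfl⟩
  rw [map_add] at h1
  have h2 := isAddUnit_of_add_isAddUnit_left h1
  simpa using h2.nsmul m

/-- The restriction map `M_f → M_g` for `D(g) ⊆ D(f)`. -/
def locMap {f g : M} (h : basicOpen g ≤ basicOpen f) :
    AddLocalization (AddSubmonoid.multiples f) →+ AddLocalization (AddSubmonoid.multiples g) :=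
  (AddLocalization.addMonoidOf (AddSubmonoid.multiples f)).lift (isAddUnit_of_basicOpen_le h)

lemma locMap_toLoc {f g : M} (h : basicOpen g ≤ basicOpen f) (m : M) :
    locMap h (toLoc f m) = toLoc g m :=
  AddSubmonoid.LocalizationMap.lift_eq _ _ _

lemma loc_hom_ext {f : M} {N : Type u} [AddCommMonoid N]
    {φ ψ : AddLocalization (AddSubmonoid.multiples f) →+ N}
    (h : ∀ m : M, φ (toLoc f m) = ψ (toLoc f m)) : φ = ψ :=
  (AddLocalization.addMonoidOf (AddSubmonoid.multiples f)).epic_of_localizationMap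
    (AddMonoidHom.ext h)

variable (M)

/-- The presheaf `D(f) ↦ M_f` on the principal open subsets of `MSpec M`. -/
def structureBasis : BasisPresheaf (TopCat.of (MSpec M)) where
  I := M
  B := basicOpen
  isBasis := by
    rw [Opens.isBasis_iff_nbhd]
    intro V p hp
    obtain ⟨f, hf, hV⟩ := exists_of_mem_open hp
    exact ⟨_, ⟨f, rfl⟩, hf, hV⟩
  stronglyQuasiCompact f κ V h := by
    obtain ⟨k, hk⟩ := Opens.mem_iSup.1 (h (maxPrime_mem f))
    exact ⟨k, basicOpen_le_of_maxPrime_mem hk⟩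
  obj f := AddCommMonCat.of (AddLocalization (AddSubmonoid.multiples f))
  res h := locMap h
  res_refl f := DFunLike.congr_fun (loc_hom_ext (φ := locMap (le_refl _)) (ψ := .id _)
    fun m => locMap_toLoc _ m)
  res_res h h' := DFunLike.congr_fun (loc_hom_ext (φ := (locMap h').comp (locMap h))
    (ψ := locMap (h'.trans h)) fun m => by
      rw [AddMonoidHom.comp_apply, locMap_toLoc, locMap_toLoc, locMap_toLoc])

/-- The global section of the structure (pre)sheaf of `MSpec M` defined by `m : M`. -/
def structureSection (m : M) : (structureBasis M).sections ⊤ :=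
  (structureBasis M).globalSection
    (fun f : M => toLoc f m)
    (fun (f g : M) (h : basicOpen g ≤ basicOpen f) => locMap_toLoc h m)

end MSpec

/-! ## Quotients of commutative monoids -/

/-- The congruence `x ∼ y ↔ ∃ n n' ∈ N, x + n = y + n'` defining the quotient monoid `M / N`. -/
def quotientCon {M : Type u} [AddCommMonoid M] (N : AddSubmonoid M) : AddCon M where
  r x y := ∃ n ∈ N, ∃ n' ∈ N, x + n = y + n'
  iseqv :=
    { refl := fun x => ⟨0, N.zero_mem, 0, N.zero_mem, rfl⟩
      symm := fun ⟨n, hn, n', hn', h⟩ => ⟨n', hn', n, hn, h.symm⟩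
      trans := fun {x y z} ⟨n, hn, n', hn', h⟩ ⟨m, hm, m', hm', h'⟩ =>
        ⟨n + m, N.add_mem hn hm, m' + n', N.add_mem hm' hn', by
          rw [← add_assoc, h, add_right_comm, h', add_assoc]⟩ }
  add' := fun {w x y z} ⟨n, hn, n', hn', h⟩ ⟨m, hm, m', hm', h'⟩ =>
    ⟨n + m, N.add_mem hn hm, n' + m', N.add_mem hn' hm', by
      rw [add_add_add_comm, h, h', add_add_add_comm]⟩

/-- The functor `M ↦ M / Mˣ`. -/
def modUnits : AddCommMonCat.{u} ⥤ AddCommMonCat.{u} where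
  obj M := AddCommMonCat.of (quotientCon (IsAddUnit.addSubmonoid M)).Quotient
  map {M N} f := AddCommMonCat.ofHom
    ((quotientCon (IsAddUnit.addSubmonoid M)).lift
      ((quotientCon (IsAddUnit.addSubmonoid N)).mk'.comp f.hom) (by
        rintro x y ⟨n, hn, n', hn', h⟩
        refine (AddCon.eq _).2 ⟨f n, IsAddUnit.map f.hom hn, f n', IsAddUnit.map f.hom hn', ?_⟩
        exact (map_add f.hom x n).symm.trans ((congrArg f.hom h).trans (map_add f.hom y n'))))
  map_id M := by
    ext x; rfl
  map_comp f g := by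
    ext x; rfl

namespace MSpec

variable (M : Type u) [AddCommMonoid M]

/-- The sheafification of the presheaf `U ↦ 𝒪(U) / 𝒪(U)ˣ`, where `𝒪` is the structure sheaf
of `MSpec M`. -/
def reducedSheaf : TopCat.Sheaf AddCommMonCat.{u} (TopCat.of (MSpec M)) :=
  (presheafToSheaf (Opens.grothendieckTopology (TopCat.of (MSpec M))) AddCommMonCat.{u}).obj
    ((structureBasis M).presheaf ⋙ modUnits)

/-- The monoidal space `(MSpec M, 𝒪̄)`. -/
def monoidalSpace : MonoidalSpace.{u} where
  carrier := TopCat.of (MSpec M)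
  presheaf := (reducedSheaf M).1
  IsSheaf := (reducedSheaf M).2

variable {M}

/-- The global section of `𝒪̄` defined by an element of `M`. -/
def reducedSection (m : M) : (monoidalSpace M).presheaf.obj (op ⊤) :=
  (toSheafify (Opens.grothendieckTopology (TopCat.of (MSpec M)))
      ((structureBasis M).presheaf ⋙ modUnits)).app (op ⊤)
    ((quotientCon (IsAddUnit.addSubmonoid ((structureBasis M).sections ⊤))).mk'
      (structureSection M m))

end MSpec

/-! ## The Grothendieck monoid of an abelian category -/

section Grothendieck

variable (A : Type u) [Category.{v} A] [Abelian A]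

/-- An additive function on the objects of `A` with values in a commutative monoid.
(Such a function is automatically invariant under isomorphisms.) -/
structure IsAdditiveFunction {A : Type u} [Category.{v} A] [Abelian A] {N : Type*}
    [AddCommMonoid N] (f : A → N) : Prop where
  map_isZero : ∀ Z : A, IsZero Z → f Z = 0
  map_shortExact : ∀ S : ShortComplex A, S.ShortExact → f S.X₂ = f S.X₁ + f S.X₃

/-- The relations defining the Grothendieck monoid, on the free commutative monoid on the
objects of `A`. -/
inductive GrothendieckRel : Multiset A → Multiset A → Prop
  | zero (Z : A) (hZ : IsZero Z) : GrothendieckRel {Z} 0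
  | shortExact (S : ShortComplex A) (hS : S.ShortExact) :
      GrothendieckRel {S.X₂} ({S.X₁} + {S.X₃})

/-- The Grothendieck monoid `M(A)`. -/
def GrothendieckMonoid : Type u := (addConGen (GrothendieckRel A)).Quotient

instance : AddCommMonoid (GrothendieckMonoid A) :=
  inferInstanceAs (AddCommMonoid (addConGen (GrothendieckRel A)).Quotient)

variable {A}

namespace GrothendieckMonoid

/-- The class `[X]` of an object in the Grothendieck monoid. -/
def mk (X : A) : GrothendieckMonoid A := (addConGen (GrothendieckRel A)).mk' {X}

lemma isAdditiveFunction_mk : IsAdditiveFunction (mk : A → GrothendieckMonoid A) where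
  map_isZero Z hZ := (AddCon.eq _).2 (AddConGen.Rel.of _ _ (.zero Z hZ))
  map_shortExact S hS := (AddCon.eq _).2 (AddConGen.Rel.of _ _ (.shortExact S hS))

/-- The universal property of the Grothendieck monoid. -/
def lift {N : Type*} [AddCommMonoid N] (f : A → N) (hf : IsAdditiveFunction f) :
    GrothendieckMonoid A →+ N :=
  (addConGen (GrothendieckRel A)).lift
    (Multiset.sumAddMonoidHom.comp (Multiset.mapAddMonoidHom f)) (AddCon.addConGen_le.2 (by
      rintro _ _ (⟨Z, hZ⟩ | ⟨S, hS⟩)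
      · simpa [AddCon.ker_rel] using hf.map_isZero Z hZ
      · simpa [AddCon.ker_rel] using hf.map_shortExact S hS))

lemma lift_mk {N : Type*} [AddCommMonoid N] (f : A → N) (hf : IsAdditiveFunction f) (X : A) :
    lift f hf (mk X) = f X := by
  change (Multiset.map f {X}).sum = f X
  simp

lemma hom_ext {N : Type*} [AddCommMonoid N] {φ ψ : GrothendieckMonoid A →+ N}
    (h : ∀ X : A, φ (mk X) = ψ (mk X)) : φ = ψ := by
  refine AddCon.hom_ext (Multiset.addHom_ext fun X => h X)

lemma mk_biprod (X Y : A) : mk (X ⊞ Y) = mk X + mk Y :=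
  isAdditiveFunction_mk.map_shortExact
    (ShortComplex.mk (biprod.inl : X ⟶ X ⊞ Y) (biprod.snd : X ⊞ Y ⟶ Y) (by simp))
    (ShortComplex.Splitting.ofHasBinaryBiproduct X Y).shortExact

lemma mk_surjective : Function.Surjective (mk : A → GrothendieckMonoid A) := by
  intro m
  obtain ⟨s, rfl⟩ := AddCon.mk'_surjective m
  induction s using Multiset.induction_on with
  | empty => exact ⟨0, (isAdditiveFunction_mk.map_isZero 0 (isZero_zero A)).trans (map_zero _).symm⟩
  | cons X s ih =>
    obtain ⟨Y, hY⟩ := ih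
    refine ⟨X ⊞ Y, ?_⟩
    rw [mk_biprod, hY, ← Multiset.singleton_add, map_add]
    rfl

variable {D : Type u} {E : Type*} [Category* D] [Abelian D] [Category* E] [Abelian E]

/-- The homomorphism `M(F) : M(D) → M(E)`, `[X] ↦ [F X]`, of an exact functor `F`. -/
def map (F : D ⥤ E) [PreservesFiniteLimits F] [PreservesFiniteColimits F] :
    GrothendieckMonoid D →+ GrothendieckMonoid E :=
  lift (fun X => mk (F.obj X))
    { map_isZero := fun _ hZ => isAdditiveFunction_mk.map_isZero _ (F.map_isZero hZ)
      map_shortExact := fun S hS =>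
        isAdditiveFunction_mk.map_shortExact (S.map F) (hS.map_of_exact F) }

lemma map_mk (F : D ⥤ E) [PreservesFiniteLimits F] [PreservesFiniteColimits F] (X : D) :
    map F (mk X) = mk (F.obj X) := lift_mk _ _ _

end GrothendieckMonoid

/-! ## The space of Serre subcategories -/

variable (A) in
/-- A Serre subcategory of the abelian category `A`. -/
@[ext]
structure SerreSubcategory where
  /-- the objects of the subcategory -/
  prop : ObjectProperty A
  isSerreClass : prop.IsSerreClass

namespace SerreSubcategory

attribute [instance] isSerreClass

/-- `V(𝒳)`, the set of Serre subcategories having no object in common with `𝒳`. -/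
def avoiding (P : ObjectProperty A) : Set (SerreSubcategory A) :=
  {S | ∀ X, S.prop X → ¬ P X}

/-- The Zariski topology: the closed subsets are the `V(𝒳)`. -/
instance : TopologicalSpace (SerreSubcategory A) :=
  TopologicalSpace.ofClosed (Set.range avoiding)
    ⟨⊤, Set.eq_empty_of_forall_notMem fun S hS =>
      hS 0 (S.prop.prop_of_isZero (isZero_zero A)) trivial⟩
    (fun T hT => ⟨fun X => ∃ P, avoiding P ∈ T ∧ P X, by
      ext S
      constructor
      · intro h Z hZ
        obtain ⟨P, rfl⟩ := hT hZ
        exact fun X hX hPX => h X hX ⟨P, hZ, hPX⟩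
      · rintro h X hX ⟨P, hP, hPX⟩
        exact h _ hP X hX hPX⟩)
    (by
      rintro _ ⟨P, rfl⟩ _ ⟨P', rfl⟩
      refine ⟨fun Z => ∃ X Y, P X ∧ P' Y ∧ Z = (X ⊞ Y : A), ?_⟩
      ext S
      constructor
      · intro h
        by_contra hS
        simp only [Set.mem_union, avoiding, Set.mem_ofPred_eq, not_or, not_forall, not_not] at hS
        obtain ⟨⟨X, hX, hPX⟩, ⟨Y, hY, hPY⟩⟩ := hS
        exact h (X ⊞ Y) (S.prop.prop_X₂_of_shortExact
          (ShortComplex.Splitting.ofHasBinaryBiproduct X Y).shortExact hX hY)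
            ⟨X, Y, hPX, hPY, rfl⟩
      · rintro (h | h) _ hZ ⟨X, Y, hX, hY, rfl⟩
        · exact h X (S.prop.prop_of_mono (biprod.inl : X ⟶ X ⊞ Y) hZ) hX
        · exact h Y (S.prop.prop_of_mono (biprod.inr : Y ⟶ X ⊞ Y) hZ) hY)

lemma isClosed_iff {Z : Set (SerreSubcategory A)} :
    IsClosed Z ↔ ∃ P : ObjectProperty A, avoiding P = Z := by
  rw [← isOpen_compl_iff]
  change Zᶜᶜ ∈ _ ↔ _
  rw [compl_compl]; rfl

/-- The open subset `U_X` of Serre subcategories containing the object `X`. -/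
def basicOpen (X : A) : Opens (SerreSubcategory A) :=
  ⟨{S | S.prop X}, by
    rw [← isClosed_compl_iff, isClosed_iff]
    refine ⟨fun Y => Y = X, ?_⟩
    ext S
    simp only [avoiding, Set.mem_ofPred_eq, Set.mem_compl_iff]
    exact ⟨fun h hX => h X hX rfl, fun h Y hY e => h (e ▸ hY)⟩⟩

lemma exists_of_mem_open {V : Opens (SerreSubcategory A)} {S : SerreSubcategory A} (hS : S ∈ V) :
    ∃ X : A, S ∈ basicOpen X ∧ basicOpen X ≤ V := by
  obtain ⟨P, hP⟩ := isClosed_iff.1 V.isOpen.isClosed_compl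
  have h : S ∉ avoiding P := by rw [hP]; exact fun h => h hS
  simp only [avoiding, Set.mem_ofPred_eq, not_forall, not_not] at h
  obtain ⟨X, hX, hPX⟩ := h
  refine ⟨X, hX, fun T hT => ?_⟩
  by_contra hTV
  have h : T ∈ avoiding P := by rw [hP]; exact hTV
  exact h X hT hPX

/-- The smallest Serre subcategory containing the object `X`. -/
def gen (X : A) : SerreSubcategory A where
  prop Y := ∀ S : SerreSubcategory A, S.prop X → S.prop Y
  isSerreClass :=
    { exists_zero := ⟨0, isZero_zero A, fun S _ => S.prop.prop_of_isZero (isZero_zero A)⟩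
      prop_of_mono := fun f _ hY S hS => S.prop.prop_of_mono f (hY S hS)
      prop_of_epi := fun f _ hY S hS => S.prop.prop_of_epi f (hY S hS)
      prop_X₂_of_shortExact := fun h h₁ h₃ S hS =>
        S.prop.prop_X₂_of_shortExact h (h₁ S hS) (h₃ S hS) }

lemma gen_mem (X : A) : gen X ∈ basicOpen X := fun _ hS => hS

lemma gen_le {X : A} {S : SerreSubcategory A} (h : S.prop X) : (gen X).prop ≤ S.prop :=
  fun _ hY => hY S h

lemma gen_le_gen {X Y : A} (h : basicOpen Y ≤ basicOpen X) : (gen X).prop ≤ (gen Y).prop :=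
  gen_le (h (gen_mem Y))

/-- The abelian quotient category `A / S`: the localization of `A` at the morphisms whose kernel
and cokernel belong to `S`. -/
abbrev Quotient (S : SerreSubcategory A) : Type u := S.prop.isoModSerre.Localization

/-- The quotient functor `A ⥤ A / S`. -/
abbrev Q (S : SerreSubcategory A) : A ⥤ S.Quotient := S.prop.isoModSerre.Q

instance (S : SerreSubcategory A) : Abelian S.Quotient :=
  ObjectProperty.SerreClassLocalization.abelian S.Q S.prop

instance (S : SerreSubcategory A) : PreservesFiniteLimits S.Q :=
  ObjectProperty.SerreClassLocalization.preservesFiniteLimits S.Q S.prop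

instance (S : SerreSubcategory A) : PreservesFiniteColimits S.Q :=
  ObjectProperty.SerreClassLocalization.preservesFiniteColimits S.Q S.prop

lemma isInvertedBy {S T : SerreSubcategory A} (h : S.prop ≤ T.prop) :
    S.prop.isoModSerre.IsInvertedBy T.Q := fun _ _ f hf =>
  T.prop.isoModSerre.Q_inverts f ⟨h _ hf.1, h _ hf.2⟩

/-- For Serre subcategories `S ⊆ T`, the functor `A / S ⥤ A / T` induced by the universal
property of `A / S`. -/
def quotientFunctor {S T : SerreSubcategory A} (h : S.prop ≤ T.prop) : S.Quotient ⥤ T.Quotient :=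
  Localization.Construction.lift T.Q (isInvertedBy h)

lemma Q_comp_quotientFunctor {S T : SerreSubcategory A} (h : S.prop ≤ T.prop) :
    S.Q ⋙ quotientFunctor h = T.Q :=
  Localization.Construction.fac _ _

instance {S T : SerreSubcategory A} (h : S.prop ≤ T.prop) :
    PreservesFiniteLimits (quotientFunctor h) := by
  rw [← ObjectProperty.SerreClassLocalization.preservesFiniteLimits_comp_iff S.Q S.prop,
    Q_comp_quotientFunctor]
  infer_instance

instance {S T : SerreSubcategory A} (h : S.prop ≤ T.prop) :
    PreservesFiniteColimits (quotientFunctor h) := by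
  rw [← ObjectProperty.SerreClassLocalization.preservesFiniteColimits_comp_iff S.Q S.prop,
    Q_comp_quotientFunctor]
  infer_instance

lemma map_quotientFunctor_mk {S T : SerreSubcategory A} (h : S.prop ≤ T.prop) (X : A) :
    GrothendieckMonoid.map (quotientFunctor h) (GrothendieckMonoid.mk (S.Q.obj X)) =
      GrothendieckMonoid.mk (T.Q.obj X) :=
  GrothendieckMonoid.map_mk _ _

lemma quotient_hom_ext {S : SerreSubcategory A} {N : Type*} [AddCommMonoid N]
    {φ ψ : GrothendieckMonoid S.Quotient →+ N}
    (h : ∀ X : A, φ (GrothendieckMonoid.mk (S.Q.obj X)) = ψ (GrothendieckMonoid.mk (S.Q.obj X))) :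
    φ = ψ :=
  GrothendieckMonoid.hom_ext fun X => by
    obtain ⟨X, rfl⟩ := (Localization.Construction.objEquiv S.prop.isoModSerre).surjective X
    exact h X

variable (A)

/-- The presheaf `U_X ↦ M(A / ⟨X⟩)` on the open subsets `U_X`, where `⟨X⟩` is the Serre subcategory
generated by `X`. -/
def basisPresheaf : BasisPresheaf (TopCat.of (SerreSubcategory A)) where
  I := A
  B := basicOpen
  isBasis := by
    rw [Opens.isBasis_iff_nbhd]
    intro V p hp
    obtain ⟨f, hf, hV⟩ := exists_of_mem_open hp
    exact ⟨_, ⟨f, rfl⟩, hf, hV⟩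
  stronglyQuasiCompact X κ V h := by
    obtain ⟨k, hk⟩ := Opens.mem_iSup.1 (h (gen_mem X))
    obtain ⟨Y, hY, hYV⟩ := exists_of_mem_open hk
    exact ⟨k, le_trans (fun S hS => gen_le hS _ hY) hYV⟩
  obj X := AddCommMonCat.of (GrothendieckMonoid (gen X).Quotient)
  res h := GrothendieckMonoid.map (quotientFunctor (gen_le_gen h))
  res_refl X := DFunLike.congr_fun (quotient_hom_ext (ψ := AddMonoidHom.id _)
    fun _ => map_quotientFunctor_mk _ _)
  res_res h h' := DFunLike.congr_fun (quotient_hom_ext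
    (φ := (GrothendieckMonoid.map (quotientFunctor (gen_le_gen h'))).comp
      (GrothendieckMonoid.map (quotientFunctor (gen_le_gen h))))
    (ψ := GrothendieckMonoid.map (quotientFunctor (gen_le_gen (h'.trans h)))) fun _ => by
      rw [AddMonoidHom.comp_apply, map_quotientFunctor_mk, map_quotientFunctor_mk,
        map_quotientFunctor_mk])

/-- The monoidal space `(Serre(A), ℳ_A)`, where `ℳ_A(V) = lim_{U_X ⊆ V} M(A / ⟨X⟩)`. -/
def monoidalSpace : MonoidalSpace.{u} where
  carrier := TopCat.of (SerreSubcategory A)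
  presheaf := (basisPresheaf A).presheaf
  IsSheaf := (basisPresheaf A).presheaf_isSheaf

variable {A}

open Classical in
/-- Serre subcategories are closed under the relation `[X] = [Y]`: the indicator of the complement,
with values `0` and `⊤`, is an additive function. -/
lemma prop_of_mk_eq {S : SerreSubcategory A} {X Y : A}
    (h : GrothendieckMonoid.mk X = GrothendieckMonoid.mk Y) : S.prop X ↔ S.prop Y := by
  have hf : IsAdditiveFunction (fun X : A => (if S.prop X then 0 else ⊤ : ℕ∞)) :=
    { map_isZero := fun Z hZ => by simp [S.prop.prop_of_isZero hZ]
      map_shortExact := fun T hT => by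
        have := S.prop.prop_iff_of_shortExact hT
        by_cases h₁ : S.prop T.X₁ <;> by_cases h₃ : S.prop T.X₃ <;> simp [this, h₁, h₃] }
  have := congrArg (GrothendieckMonoid.lift _ hf) h
  rw [GrothendieckMonoid.lift_mk, GrothendieckMonoid.lift_mk] at this
  by_cases h₁ : S.prop X <;> by_cases h₂ : S.prop Y <;> simp [h₁, h₂] at this ⊢

/-- The face `M_S = {[X] | X ∈ S}` of `M(A)`. -/
def face (S : SerreSubcategory A) : Set (GrothendieckMonoid A) :=
  {m | ∃ X, S.prop X ∧ GrothendieckMonoid.mk X = m}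

lemma mk_mem_face {S : SerreSubcategory A} {X : A} :
    GrothendieckMonoid.mk X ∈ S.face ↔ S.prop X :=
  ⟨fun ⟨_, hY, h⟩ => (prop_of_mk_eq h).1 hY, fun h => ⟨X, h, rfl⟩⟩

lemma add_mem_face {S : SerreSubcategory A} {m n : GrothendieckMonoid A} :
    m + n ∈ S.face ↔ m ∈ S.face ∧ n ∈ S.face := by
  obtain ⟨X, rfl⟩ := GrothendieckMonoid.mk_surjective m
  obtain ⟨Y, rfl⟩ := GrothendieckMonoid.mk_surjective n
  rw [← GrothendieckMonoid.mk_biprod, mk_mem_face, mk_mem_face, mk_mem_face]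
  exact S.prop.prop_iff_of_shortExact (ShortComplex.Splitting.ofHasBinaryBiproduct X Y).shortExact

/-- The map `Serre(A) → MSpec M(A)`, `S ↦ M(A) \ M_S`. -/
def toMSpec (S : SerreSubcategory A) : MSpec (GrothendieckMonoid A) where
  carrier := S.faceᶜ
  add_mem _ hx h := hx (add_mem_face.1 h).1
  ne_univ h := by
    have : GrothendieckMonoid.mk (0 : A) ∈ S.faceᶜ := h ▸ Set.mem_univ _
    exact this (mk_mem_face.2 (S.prop.prop_of_isZero (isZero_zero A)))
  mem_or_mem {x y} h := by
    by_contra hc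
    rw [not_or] at hc
    exact h (add_mem_face.2 ⟨not_not.1 hc.1, not_not.1 hc.2⟩)

end SerreSubcategory

end Grothendieck

end

noncomputable section

/-! ### Grothendieck monoids of quotient categories -/

namespace GrothendieckMonoid

variable {A : Type u} [Category.{v} A] [Abelian A]

/-! Short exact sequences become sums in `GrothendieckMonoid A`, and the complement of a prime ideal
is a face, so Serre subcategories of `A` correspond to faces of the monoid. Under this bijection
`U_X` matches `D([X])`; since every element of the monoid is some `[X]`, bases correspond and the
bijection is a homeomorphism.

The sheaves are compared on these bases, through the natural map `M(A)_[X] → M(A / ⟨X⟩)`. It is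
surjective, and two facts show that it identifies exactly the elements that agree up to units. By
`quotientCon_of_map_Q_eq`, `M(A / S)` is `M(A)` modulo the face of `S`, and the face of `⟨X⟩`
consists of elements that become units in `M(A)_[X]` (`isAddUnit_toLoc`). By `eq_zero_of_isAddUnit`,
Grothendieck monoids are reduced, so every unit of `M(A)_[X]` is killed.

Hence `𝒪 / 𝒪ˣ ⟶ Φ_* ℳ_A` is locally injective and locally surjective. Its target is already a sheaf,
so it induces an isomorphism from the sheafification. Isomorphisms of presheafed spaces are
automatically local on stalks. -/

lemma mk_eq_of_iso {X Y : A} (e : X ≅ Y) : mk X = mk Y := by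
  have h := isAdditiveFunction_mk.map_shortExact (ShortComplex.mk e.hom (0 : Y ⟶ 0) (by simp))
    { exact := by
        rw [ShortComplex.exact_iff_epi _ rfl]
        dsimp; infer_instance
      mono_f := by dsimp; infer_instance
      epi_g := ⟨fun _ _ _ => (isZero_zero A).eq_of_src _ _⟩ }
  rw [isAdditiveFunction_mk.map_isZero _ (isZero_zero A), add_zero] at h
  exact h.symm

/-- The classes of the source and the target of a morphism differ by those of its kernel and
cokernel. -/
lemma mk_add_mk_cokernel {X Y : A} (f : X ⟶ Y) :
    mk X + mk (cokernel f) = mk Y + mk (kernel f) := by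
  have h₁ : mk X = mk (kernel f) + mk (Abelian.coimage f) :=
    isAdditiveFunction_mk.map_shortExact (ShortComplex.mk (kernel.ι f) (cokernel.π (kernel.ι f))
      (by simp)) { exact := ShortComplex.exact_cokernel _ }
  have h₂ : mk Y = mk (Abelian.image f) + mk (cokernel f) :=
    isAdditiveFunction_mk.map_shortExact (ShortComplex.mk (kernel.ι (cokernel.π f)) (cokernel.π f)
      (by simp)) { exact := ShortComplex.exact_kernel _ }
  rw [h₁, h₂, mk_eq_of_iso (Abelian.coimageIsoImage f)]
  abel

end GrothendieckMonoid

namespace SerreSubcategory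

variable {A : Type u} [Category.{v} A] [Abelian A]

open GrothendieckMonoid hiding mk mk_surjective

/-- The face `M_S` as a submonoid of `M(A)`. -/
def faceSubmonoid (S : SerreSubcategory A) : AddSubmonoid (GrothendieckMonoid A) where
  carrier := S.face
  zero_mem' := ⟨0, S.prop.prop_of_isZero (isZero_zero A),
    isAdditiveFunction_mk.map_isZero 0 (isZero_zero A)⟩
  add_mem' h₁ h₂ := add_mem_face.2 ⟨h₁, h₂⟩

/-- The kernel and cokernel of `f` lie in `S`, so `mk_add_mk_cokernel` is itself an instance of the
congruence. -/
lemma quotientCon_of_isoModSerre {S : SerreSubcategory A} {X Y : A} (f : X ⟶ Y)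
    (hf : S.prop.isoModSerre f) :
    quotientCon S.faceSubmonoid (GrothendieckMonoid.mk X) (GrothendieckMonoid.mk Y) :=
  ⟨_, mk_mem_face.2 hf.2, _, mk_mem_face.2 hf.1, mk_add_mk_cokernel f⟩

/-- An isomorphism in `A / S` is represented by a roof `X ⟵ X' ⟶ Y`. Its left leg is inverted by
`S.Q` by construction, hence so is its right leg, and a morphism inverted by `S.Q` has kernel and
cokernel in `S`. The congruence therefore passes along both legs. -/
lemma quotientCon_of_iso {S : SerreSubcategory A} {X Y : A} (e : S.Q.obj X ≅ S.Q.obj Y) :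
    quotientCon S.faceSubmonoid (GrothendieckMonoid.mk X) (GrothendieckMonoid.mk Y) := by
  obtain ⟨φ, hφ⟩ := Localization.exists_rightFraction S.Q S.prop.isoModSerre e.hom
  have hs := Localization.inverts S.Q S.prop.isoModSerre φ.s φ.hs
  have hf : IsIso (S.Q.map φ.f) := by
    rw [← MorphismProperty.RightFraction.map_s_comp_map φ S.Q
      (Localization.inverts S.Q S.prop.isoModSerre), ← hφ]
    infer_instance
  rw [ObjectProperty.SerreClassLocalization.isIso_map_iff S.Q S.prop] at hf
  exact (quotientCon _).trans ((quotientCon _).symm (quotientCon_of_isoModSerre φ.s φ.hs))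
    (quotientCon_of_isoModSerre φ.f hf)

/-- The class in `M(A) / M_S` of an object of `A / S`. -/
def quotientClass (S : SerreSubcategory A) (Z : S.Quotient) :
    (quotientCon S.faceSubmonoid).Quotient :=
  (quotientCon S.faceSubmonoid).mk'
    (GrothendieckMonoid.mk ((Localization.Construction.objEquiv _).symm Z))

/-- `quotientClass` uses the literal object of `A` underlying `Z`; this frees it from that choice,
so that any lift of `Z` up to isomorphism may be used. -/
lemma quotientClass_eq {S : SerreSubcategory A} {X : A} {Z : S.Quotient} (e : S.Q.obj X ≅ Z) :
    S.quotientClass Z = (quotientCon S.faceSubmonoid).mk' (GrothendieckMonoid.mk X) := by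
  obtain ⟨Y, rfl⟩ := (Localization.Construction.objEquiv S.prop.isoModSerre).surjective Z
  rw [quotientClass, Equiv.symm_apply_apply]
  exact (AddCon.eq _).2 (quotientCon_of_iso e.symm)

/-- A short exact sequence in `A / S` is, up to isomorphism, the image of one in `A`, where
additivity is known. The resulting homomorphism out of `M(A / S)` is what detects equality modulo
the face. -/
lemma isAdditiveFunction_quotientClass (S : SerreSubcategory A) :
    IsAdditiveFunction S.quotientClass where
  map_isZero Z hZ := by
    obtain ⟨X, rfl⟩ := (Localization.Construction.objEquiv S.prop.isoModSerre).surjective Z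
    refine (quotientClass_eq (Iso.refl (S.Q.obj X))).trans ?_
    have hX : S.prop X := (ObjectProperty.SerreClassLocalization.isZero_obj_iff S.Q S.prop X).1 hZ
    exact (AddCon.eq _).2 ⟨0, zero_mem _, _, mk_mem_face.2 hX, by simp⟩
  map_shortExact T hT := by
    have := hT.mono_f
    have := hT.epi_g
    -- Every monomorphism of `A / S` is isomorphic, as an arrow, to the image of a monomorphism of
    -- `A`.
    obtain ⟨X, Y, f, _, ⟨e⟩⟩ :=
      (ObjectProperty.SerreClassLocalization.mono_iff S.Q S.prop T.f).1 inferInstance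
    have e₁ : S.Q.obj X ≅ T.X₁ := Arrow.leftFunc.mapIso e
    have e₂ : S.Q.obj Y ≅ T.X₂ := Arrow.rightFunc.mapIso e
    -- The third term needs no separate lifting: `S.Q` preserves cokernels, and `T.X₃` is the
    -- cokernel of `T.f`.
    have e₃ : S.Q.obj (cokernel f) ≅ T.X₃ :=
      PreservesCokernel.iso S.Q f ≪≫
        cokernel.mapIso _ _ (Arrow.leftFunc.mapIso e) (Arrow.rightFunc.mapIso e) e.hom.w.symm ≪≫
        (colimit.isColimit (parallelPair T.f 0)).coconePointUniqueUpToIso hT.gIsCokernel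
    rw [quotientClass_eq e₂, quotientClass_eq e₁,
      quotientClass_eq e₃, ← map_add]
    exact congrArg _ (isAdditiveFunction_mk.map_shortExact
      (ShortComplex.mk f (cokernel.π f) (by simp)) { exact := ShortComplex.exact_cokernel _ })

/-- `M(A / S) = M(A) / M_S`: equality of classes in `M(A / S)` is equality in `M(A)` up to
elements of the face `M_S`. -/
lemma quotientCon_of_map_Q_eq {S : SerreSubcategory A} {m n : GrothendieckMonoid A}
    (h : GrothendieckMonoid.map S.Q m = GrothendieckMonoid.map S.Q n) :
    quotientCon S.faceSubmonoid m n := by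
  obtain ⟨X, rfl⟩ := GrothendieckMonoid.mk_surjective m
  obtain ⟨Y, rfl⟩ := GrothendieckMonoid.mk_surjective n
  have := congrArg (GrothendieckMonoid.lift _ S.isAdditiveFunction_quotientClass) h
  rw [map_mk, map_mk, lift_mk, lift_mk, quotientClass_eq (Iso.refl _),
    quotientClass_eq (Iso.refl _)] at this
  exact (AddCon.eq _).1 this

lemma map_Q_surjective (S : SerreSubcategory A) :
    Function.Surjective (GrothendieckMonoid.map S.Q) := by
  intro m
  obtain ⟨Z, rfl⟩ := GrothendieckMonoid.mk_surjective m
  obtain ⟨X, rfl⟩ := (Localization.Construction.objEquiv S.prop.isoModSerre).surjective Z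
  exact ⟨GrothendieckMonoid.mk X, map_mk _ _⟩

lemma map_Q_eq_zero {S : SerreSubcategory A} {m : GrothendieckMonoid A} (h : m ∈ S.face) :
    GrothendieckMonoid.map S.Q m = 0 := by
  obtain ⟨X, hX, rfl⟩ := h
  rw [map_mk]
  exact isAdditiveFunction_mk.map_isZero _
    ((ObjectProperty.SerreClassLocalization.isZero_obj_iff S.Q S.prop X).2 hX)

end SerreSubcategory

/-! ### Reducedness -/

namespace GrothendieckMonoid

variable {A : Type u} [Category.{v} A] [Abelian A]

/-- The Serre subcategory of zero objects. -/
def zeroSerre (A : Type u) [Category.{v} A] [Abelian A] : SerreSubcategory A where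
  prop := IsZero
  isSerreClass := inferInstance

/-- The Grothendieck monoid is reduced. -/
lemma eq_zero_of_isAddUnit {m : GrothendieckMonoid A} (h : IsAddUnit m) : m = 0 := by
  obtain ⟨n, hn⟩ := h.exists_neg
  -- A face contains the summands of its elements, and the face of the zero objects is `{0}`.
  have h0 : m + n ∈ (zeroSerre A).face := hn ▸ (zeroSerre A).faceSubmonoid.zero_mem
  obtain ⟨X, hX, rfl⟩ := (SerreSubcategory.add_mem_face.1 h0).1
  exact isAdditiveFunction_mk.map_isZero _ hX

end GrothendieckMonoid

/-! ### The homeomorphism between Serre subcategories and prime ideals -/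

namespace SerreSubcategory

variable {A : Type u} [Category.{v} A] [Abelian A]

/-- The single dictionary entry `Φ⁻¹ D([X]) = U_X`, from which both the bijection and the
homeomorphism follow. -/
lemma toMSpec_mem_basicOpen {S : SerreSubcategory A} {X : A} :
    toMSpec S ∈ MSpec.basicOpen (GrothendieckMonoid.mk X) ↔ S.prop X := by
  rw [MSpec.mem_basicOpen, ← mk_mem_face]
  exact not_not

/-- The Serre subcategory of objects whose class does not belong to a prime ideal. -/
def ofMSpec (p : MSpec (GrothendieckMonoid A)) : SerreSubcategory A where
  prop X := GrothendieckMonoid.mk X ∉ p.carrier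
  isSerreClass :=
    -- The complement of a prime ideal contains a sum exactly when it contains both summands;
    -- applied to `[X₂] = [X₁] + [X₃]` this yields all the closure properties.
    have key (T : ShortComplex A) (hT : T.ShortExact) :
        GrothendieckMonoid.mk T.X₂ ∉ p.carrier ↔
          GrothendieckMonoid.mk T.X₁ ∉ p.carrier ∧ GrothendieckMonoid.mk T.X₃ ∉ p.carrier := by
      rw [GrothendieckMonoid.isAdditiveFunction_mk.map_shortExact T hT, ← not_or, not_iff_not]
      exact ⟨p.mem_or_mem, fun h => h.elim (p.add_mem _) fun h => by
        rw [add_comm]; exact p.add_mem _ h⟩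
    { exists_zero := ⟨0, isZero_zero A, by
        rw [GrothendieckMonoid.isAdditiveFunction_mk.map_isZero 0 (isZero_zero A)]
        exact p.zero_notMem⟩
      prop_of_mono := fun f _ hY =>
        ((key (ShortComplex.mk f (cokernel.π f) (by simp))
          { exact := ShortComplex.exact_cokernel _ }).1 hY).1
      prop_of_epi := fun f _ hX =>
        ((key (ShortComplex.mk (kernel.ι f) f (by simp))
          { exact := ShortComplex.exact_kernel _ }).1 hX).2
      prop_X₂_of_shortExact := fun hT h₁ h₃ => (key _ hT).2 ⟨h₁, h₃⟩ }

lemma toMSpec_ofMSpec (p : MSpec (GrothendieckMonoid A)) : toMSpec (ofMSpec p) = p := by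
  ext m
  obtain ⟨X, rfl⟩ := GrothendieckMonoid.mk_surjective m
  exact not_iff_not.1 toMSpec_mem_basicOpen

lemma ofMSpec_toMSpec (S : SerreSubcategory A) : ofMSpec (toMSpec S) = S := by
  ext X
  exact toMSpec_mem_basicOpen

variable (A) in
/-- The bijection between Serre subcategories and prime ideals of the Grothendieck monoid. -/
def equivMSpec : SerreSubcategory A ≃ MSpec (GrothendieckMonoid A) where
  toFun := toMSpec
  invFun := ofMSpec
  left_inv := ofMSpec_toMSpec
  right_inv := toMSpec_ofMSpec

variable (A) in
/-- The homeomorphism between Serre subcategories and prime ideals of the Grothendieck monoid. -/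
def homeoMSpec : SerreSubcategory A ≃ₜ MSpec (GrothendieckMonoid A) :=
  (equivMSpec A).toHomeomorphOfContinuousOpen
    (by
      refine (MSpec.structureBasis (GrothendieckMonoid A)).isBasis.continuous_iff.2 ?_
      rintro _ ⟨_, ⟨m, rfl⟩, rfl⟩
      obtain ⟨X, rfl⟩ := GrothendieckMonoid.mk_surjective m
      convert (basicOpen X).isOpen using 1
      ext S
      exact toMSpec_mem_basicOpen)
    (by
      refine (basisPresheaf A).isBasis.isOpenMap_iff.2 ?_
      rintro _ ⟨_, ⟨(X : A), rfl⟩, rfl⟩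
      have h : equivMSpec A '' {S | S.prop X} = MSpec.basicOpen (GrothendieckMonoid.mk X) := by
        ext p
        obtain ⟨S, rfl⟩ := (equivMSpec A).surjective p
        rw [(equivMSpec A).injective.mem_set_image]
        exact toMSpec_mem_basicOpen.symm
      exact h ▸ (MSpec.basicOpen (GrothendieckMonoid.mk X)).isOpen)

variable (A) in
/-- The homeomorphism `homeoMSpec` as an isomorphism of topological spaces. -/
def isoMSpec : TopCat.of (SerreSubcategory A) ≅ TopCat.of (MSpec (GrothendieckMonoid A)) :=
  TopCat.isoOfHomeo (homeoMSpec A)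

/-- Matches the index sets of the limits defining `ℳ_A(Φ⁻¹ V)` and `𝒪(V)`. -/
lemma basicOpen_le_map_iff {X : A} {V : Opens (TopCat.of (MSpec (GrothendieckMonoid A)))} :
    basicOpen X ≤ (Opens.map (isoMSpec A).hom).obj V ↔
      MSpec.basicOpen (GrothendieckMonoid.mk X) ≤ V := by
  refine ⟨fun h p hp => ?_, fun h S hS => h (toMSpec_mem_basicOpen.2 hS)⟩
  obtain ⟨S, rfl⟩ := (equivMSpec A).surjective p
  exact h (toMSpec_mem_basicOpen.1 hp)

lemma basicOpen_mk_le_iff {X Y : A} :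
    MSpec.basicOpen (GrothendieckMonoid.mk Y) ≤ MSpec.basicOpen (GrothendieckMonoid.mk X) ↔
      basicOpen Y ≤ basicOpen X := by
  rw [← basicOpen_le_map_iff]
  exact forall_congr' fun S => imp_congr_right fun _ => toMSpec_mem_basicOpen

/-! ### Comparison over a basic open set -/

/-- The homomorphism `M(A)_[X] → M(A / ⟨X⟩)` induced by the quotient functor. -/
def locToQuotient (X : A) :
    AddLocalization (AddSubmonoid.multiples (GrothendieckMonoid.mk X)) →+
      GrothendieckMonoid (gen X).Quotient :=
  (AddLocalization.addMonoidOf _).lift (g := GrothendieckMonoid.map (gen X).Q) (by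
    rintro ⟨_, n, rfl⟩
    have h : GrothendieckMonoid.map (gen X).Q (GrothendieckMonoid.mk X) = 0 :=
      map_Q_eq_zero (mk_mem_face.2 (gen_mem X))
    simp [h])

lemma locToQuotient_toLoc (X : A) (m : GrothendieckMonoid A) :
    locToQuotient X (MSpec.toLoc _ m) = GrothendieckMonoid.map (gen X).Q m :=
  AddSubmonoid.LocalizationMap.lift_eq _ _ _

lemma locToQuotient_surjective (X : A) : Function.Surjective (locToQuotient X) := fun m => by
  obtain ⟨m, rfl⟩ := map_Q_surjective _ m
  exact ⟨_, locToQuotient_toLoc X m⟩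

/-- If `Y ∈ ⟨X⟩` then `U_X ⊆ U_Y`, hence `D([X]) ⊆ D([Y])`: some multiple of `[X]` has `[Y]` as a
summand, so inverting `[X]` inverts `[Y]`. -/
lemma isAddUnit_toLoc {X : A} {m : GrothendieckMonoid A} (h : m ∈ (gen X).face) :
    IsAddUnit (MSpec.toLoc (GrothendieckMonoid.mk X) m) := by
  obtain ⟨Y, hY, rfl⟩ := h
  exact MSpec.isAddUnit_of_basicOpen_le (basicOpen_mk_le_iff.2 fun S hS => hY S hS)
    ⟨_, AddSubmonoid.mem_multiples _⟩

lemma exists_toLoc_eq_add {M : Type*} [AddCommMonoid M] {f : M}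
    (a : AddLocalization (AddSubmonoid.multiples f)) :
    ∃ (m : M) (u : AddLocalization (AddSubmonoid.multiples f)), IsAddUnit u ∧
      a + u = MSpec.toLoc f m := by
  obtain ⟨⟨m, s⟩, h⟩ := (AddLocalization.addMonoidOf (AddSubmonoid.multiples f)).surj a
  exact ⟨m, _, (AddLocalization.addMonoidOf _).map_addUnits s, h⟩

/-- `M(A / ⟨X⟩)` is the quotient of `M(A)_[X]` by its units. -/
lemma quotientCon_of_locToQuotient_eq {X : A}
    {a b : AddLocalization (AddSubmonoid.multiples (GrothendieckMonoid.mk X))}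
    (h : locToQuotient X a = locToQuotient X b) :
    quotientCon (IsAddUnit.addSubmonoid _) a b := by
  -- Units go to units, and `M(A / ⟨X⟩)` is reduced.
  have hu {u} (hu : IsAddUnit u) : locToQuotient X u = 0 :=
    GrothendieckMonoid.eq_zero_of_isAddUnit (hu.map (locToQuotient X))
  obtain ⟨m, u, hu₁, hm⟩ := exists_toLoc_eq_add a
  obtain ⟨n, v, hv₁, hn⟩ := exists_toLoc_eq_add b
  have h' : GrothendieckMonoid.map (gen X).Q m = GrothendieckMonoid.map (gen X).Q n := by
    rw [← locToQuotient_toLoc, ← locToQuotient_toLoc, ← hm, ← hn, map_add, map_add, h, hu hu₁,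
      hu hv₁]
  obtain ⟨s, hs, t, ht, hst⟩ := quotientCon_of_map_Q_eq h'
  -- `u` and `v` clear the denominators of `a` and `b`; `s` and `t` come from the face of `⟨X⟩` and
  -- so become units in the localization.
  refine ⟨u + MSpec.toLoc _ s, hu₁.add (isAddUnit_toLoc hs), v + MSpec.toLoc _ t,
    hv₁.add (isAddUnit_toLoc ht), ?_⟩
  rw [← add_assoc, ← add_assoc, hm, hn, ← map_add, ← map_add, hst]

/-- Homomorphisms out of a localization are determined on `M(A)`, where both sides send `[Z]` to the
class of the image of `Z`. This makes the comparison maps preserve compatible families. -/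
lemma map_quotientFunctor_locToQuotient {X Y : A} (h : basicOpen Y ≤ basicOpen X)
    (a : AddLocalization (AddSubmonoid.multiples (GrothendieckMonoid.mk X))) :
    GrothendieckMonoid.map (quotientFunctor (gen_le_gen h)) (locToQuotient X a) =
      locToQuotient Y (MSpec.locMap (basicOpen_mk_le_iff.2 h) a) := by
  refine DFunLike.congr_fun (MSpec.loc_hom_ext
    (φ := (GrothendieckMonoid.map (quotientFunctor (gen_le_gen h))).comp (locToQuotient X))
    (ψ := (locToQuotient Y).comp (MSpec.locMap (basicOpen_mk_le_iff.2 h))) fun m => ?_) a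
  obtain ⟨Z, rfl⟩ := GrothendieckMonoid.mk_surjective m
  rw [AddMonoidHom.comp_apply, AddMonoidHom.comp_apply, MSpec.locMap_toLoc, locToQuotient_toLoc,
    locToQuotient_toLoc, GrothendieckMonoid.map_mk, map_quotientFunctor_mk,
    GrothendieckMonoid.map_mk]

/-! ### The morphism of presheaves -/

/-- The homomorphism `𝒪(V) → M(A)_[X] → M(A / ⟨X⟩)` for `U_X ⊆ Φ⁻¹ V`. -/
def sectionsToQuotient (V : Opens (TopCat.of (MSpec (GrothendieckMonoid A)))) (X : A)
    (h : basicOpen X ≤ (Opens.map (isoMSpec A).hom).obj V) :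
    (MSpec.structureBasis (GrothendieckMonoid A)).sections V →+
      GrothendieckMonoid (gen X).Quotient :=
  (locToQuotient X).comp ((MSpec.structureBasis (GrothendieckMonoid A)).eval
    (GrothendieckMonoid.mk X) (basicOpen_le_map_iff.1 h))

/-- The homomorphism `𝒪(V) → ℳ_A(Φ⁻¹ V)` given by the homomorphisms `M(A)_[X] → M(A / ⟨X⟩)`. -/
def sectionsHom (V : Opens (TopCat.of (MSpec (GrothendieckMonoid A)))) :
    (MSpec.structureBasis (GrothendieckMonoid A)).sections V →+
      (basisPresheaf A).sections ((Opens.map (isoMSpec A).hom).obj V) where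
  toFun s := ⟨fun X => sectionsToQuotient V X.1 X.2 s, fun X Y h =>
    (map_quotientFunctor_locToQuotient h _).trans (congrArg (locToQuotient (A := A) Y.1)
      (s.2 ⟨_, basicOpen_le_map_iff.1 X.2⟩ ⟨_, basicOpen_le_map_iff.1 Y.2⟩
        (basicOpen_mk_le_iff.2 h)))⟩
  map_zero' := Subtype.ext (funext fun X => map_zero (sectionsToQuotient V X.1 X.2))
  map_add' s t := Subtype.ext (funext fun X => map_add (sectionsToQuotient V X.1 X.2) s t)

/-- Every component takes values in a reduced monoid; hence `sectionsHom` factors through `𝒪(V) /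
𝒪(V)ˣ`. -/
lemma sectionsHom_eq_zero {V : Opens (TopCat.of (MSpec (GrothendieckMonoid A)))}
    {u : (MSpec.structureBasis (GrothendieckMonoid A)).sections V} (hu : IsAddUnit u) :
    sectionsHom V u = 0 :=
  Subtype.ext (funext fun X =>
    GrothendieckMonoid.eq_zero_of_isAddUnit (hu.map (sectionsToQuotient V X.1 X.2)))

lemma sectionsHom_restrict {V W : Opens (TopCat.of (MSpec (GrothendieckMonoid A)))} (h : W ≤ V)
    (s : (MSpec.structureBasis (GrothendieckMonoid A)).sections V) :
    sectionsHom W ((MSpec.structureBasis (GrothendieckMonoid A)).restrict h s) =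
      (basisPresheaf A).restrict ((Opens.map (isoMSpec A).hom).monotone h) (sectionsHom V s) := rfl

/-- The homomorphism `𝒪(V) / 𝒪(V)ˣ → ℳ_A(Φ⁻¹ V)` induced by `sectionsHom`. -/
def modUnitsApp (V : Opens (TopCat.of (MSpec (GrothendieckMonoid A)))) :
    (quotientCon (IsAddUnit.addSubmonoid
      ((MSpec.structureBasis (GrothendieckMonoid A)).sections V))).Quotient →+
      (basisPresheaf A).sections ((Opens.map (isoMSpec A).hom).obj V) :=
  (quotientCon _).lift (sectionsHom V) (by
    rintro s t ⟨u, hu, v, hv, h⟩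
    have := congrArg (sectionsHom V) h
    rwa [map_add, map_add, sectionsHom_eq_zero hu, sectionsHom_eq_zero hv, add_zero,
      add_zero] at this)

variable (A) in
/-- The morphism of presheaves `𝒪 / 𝒪ˣ ⟶ Φ_* ℳ_A`. -/
def modUnitsHom : (MSpec.structureBasis (GrothendieckMonoid A)).presheaf ⋙ modUnits ⟶
    (TopCat.Presheaf.pushforward _ (isoMSpec A).hom).obj (basisPresheaf A).presheaf where
  app V := AddCommMonCat.ofHom (modUnitsApp V.unop)
  naturality _ _ f := AddCommMonCat.hom_ext (AddCon.hom_ext (AddMonoidHom.ext fun s =>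
    sectionsHom_restrict f.unop.le s))

end SerreSubcategory

/-! ### Sheafification and local bijectivity -/

/-- Followed by the unit of `Q`, an isomorphism because `Q` is a sheaf, the lift becomes the
sheafification of `φ`, an isomorphism because `φ` lies in `J.W`. -/
lemma isIso_sheafifyLift {C : Type*} [Category* C] (J : GrothendieckTopology C) {D : Type*}
    [Category* D] [HasWeakSheafify J D] {P Q : Cᵒᵖ ⥤ D} {φ : P ⟶ Q} (hφ : J.W φ)
    (hQ : Presheaf.IsSheaf J Q) : IsIso (sheafifyLift J φ hQ) := by
  rw [J.W_iff] at hφ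
  have h : IsIso (sheafifyMap J φ) :=
    inferInstanceAs (IsIso ((sheafToPresheaf J D).map ((presheafToSheaf J D).map φ)))
  have := isIso_toSheafify J hQ
  have h' : sheafifyMap J φ = sheafifyLift J φ hQ ≫ toSheafify J Q :=
    sheafify_hom_ext J _ _ ((presheafToSheaf J D).obj Q).property (by
      rw [← Category.assoc, toSheafify_sheafifyLift, toSheafify_naturality])
  rw [h'] at h
  exact IsIso.of_isIso_comp_right _ (toSheafify J Q)

namespace SerreSubcategory

variable {A : Type u} [Category.{v} A] [Abelian A]

/-- Sections over `D([X])` are just `M(A)_[X]`, so `quotientCon_of_locToQuotient_eq` applies there;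
this is local injectivity. -/
lemma quotientCon_restrict_of_sectionsHom_eq
    {V : Opens (TopCat.of (MSpec (GrothendieckMonoid A)))}
    {s t : (MSpec.structureBasis (GrothendieckMonoid A)).sections V}
    (h : sectionsHom V s = sectionsHom V t) (X : A)
    (hX : MSpec.basicOpen (GrothendieckMonoid.mk X) ≤ V) :
    quotientCon (IsAddUnit.addSubmonoid _)
      ((MSpec.structureBasis (GrothendieckMonoid A)).restrict hX s)
      ((MSpec.structureBasis (GrothendieckMonoid A)).restrict hX t) := by
  let F := MSpec.structureBasis (GrothendieckMonoid A)
  let e : F.sections (MSpec.basicOpen (GrothendieckMonoid.mk X)) ≃+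
      AddLocalization (AddSubmonoid.multiples (GrothendieckMonoid.mk X)) :=
    AddEquiv.ofBijective (F.eval (GrothendieckMonoid.mk X) (le_refl _))
      (F.eval_bijective (GrothendieckMonoid.mk X))
  obtain ⟨a, ha, b, hb, hab⟩ := quotientCon_of_locToQuotient_eq
    (congrArg ((basisPresheaf A).eval X (basicOpen_le_map_iff.2 hX)) h)
  -- The units found in `M(A)_[X]` are transported back to sections over `D([X])`.
  refine ⟨e.symm a, ha.map e.symm, e.symm b, hb.map e.symm, e.injective ?_⟩
  rw [map_add, map_add, e.apply_symm_apply, e.apply_symm_apply]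
  exact hab

/-- Only the component at `X` has to be lifted: over `U_X` it determines all others by restriction.
This is local surjectivity. -/
lemma exists_sectionsHom_eq_restrict {V : Opens (TopCat.of (MSpec (GrothendieckMonoid A)))}
    (t : (basisPresheaf A).sections ((Opens.map (isoMSpec A).hom).obj V)) (X : A)
    (hX : MSpec.basicOpen (GrothendieckMonoid.mk X) ≤ V) :
    ∃ s, sectionsHom (MSpec.basicOpen (GrothendieckMonoid.mk X)) s =
      (basisPresheaf A).restrict ((Opens.map (isoMSpec A).hom).monotone hX) t := by
  obtain ⟨a, ha⟩ := locToQuotient_surjective X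
    ((basisPresheaf A).eval X (basicOpen_le_map_iff.2 hX) t)
  obtain ⟨s, rfl⟩ := ((MSpec.structureBasis (GrothendieckMonoid A)).eval_bijective
    (GrothendieckMonoid.mk X)).2 a
  refine ⟨s, (basisPresheaf A).sections_ext fun Y hY => ?_⟩
  have hX' : basicOpen X ≤ (Opens.map (isoMSpec A).hom).obj
    (MSpec.basicOpen (GrothendieckMonoid.mk X)) := basicOpen_le_map_iff.2 le_rfl
  have hYX : basicOpen (A := A) Y ≤ basicOpen X :=
    basicOpen_mk_le_iff.1 (basicOpen_le_map_iff.1 hY)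
  have h₁ := (sectionsHom _ s).2 ⟨X, hX'⟩ ⟨Y, hY⟩ hYX
  have h₂ := t.2 ⟨X, basicOpen_le_map_iff.2 hX⟩
    ⟨Y, hY.trans ((Opens.map (isoMSpec A).hom).monotone hX)⟩ hYX
  exact h₁.symm.trans ((congrArg ((basisPresheaf A).res hYX) ha).trans h₂)

lemma exists_mk_mem_basicOpen {V : Opens (TopCat.of (MSpec (GrothendieckMonoid A)))}
    {p : MSpec (GrothendieckMonoid A)} (hp : p ∈ V) :
    ∃ X : A, p ∈ MSpec.basicOpen (GrothendieckMonoid.mk X) ∧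
      MSpec.basicOpen (GrothendieckMonoid.mk X) ≤ V := by
  obtain ⟨m, hm⟩ := MSpec.exists_of_mem_open hp
  obtain ⟨X, rfl⟩ := GrothendieckMonoid.mk_surjective m
  exact ⟨X, hm⟩

instance : Presheaf.IsLocallyInjective
    (Opens.grothendieckTopology (TopCat.of (MSpec (GrothendieckMonoid A)))) (modUnitsHom A) where
  equalizerSieve_mem {V} s t h p hp := by
    obtain ⟨s, rfl⟩ := AddCon.mk'_surjective s
    obtain ⟨t, rfl⟩ := AddCon.mk'_surjective t
    obtain ⟨X, hpX, hX⟩ := exists_mk_mem_basicOpen hp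
    exact ⟨_, homOfLE hX, (AddCon.eq _).2 (quotientCon_restrict_of_sectionsHom_eq h X hX), hpX⟩

instance : Presheaf.IsLocallySurjective
    (Opens.grothendieckTopology (TopCat.of (MSpec (GrothendieckMonoid A)))) (modUnitsHom A) where
  imageSieve_mem {V} t p hp := by
    obtain ⟨X, hpX, hX⟩ := exists_mk_mem_basicOpen hp
    obtain ⟨s, hs⟩ := exists_sectionsHom_eq_restrict t X hX
    exact ⟨_, homOfLE hX, ⟨(quotientCon (IsAddUnit.addSubmonoid
      ((MSpec.structureBasis (GrothendieckMonoid A)).sections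
        (MSpec.basicOpen (GrothendieckMonoid.mk X))))).mk' s, hs⟩, hpX⟩

lemma pushforward_isSheaf : TopCat.Presheaf.IsSheaf
    ((TopCat.Presheaf.pushforward _ (isoMSpec A).hom).obj (basisPresheaf A).presheaf) :=
  TopCat.Sheaf.pushforward_sheaf_of_sheaf _ (basisPresheaf A).presheaf_isSheaf

variable (A) in
/-- The morphism of sheaves `𝒪̄ ⟶ Φ_* ℳ_A`. -/
def reducedSheafHom : (MSpec.reducedSheaf (GrothendieckMonoid A)).1 ⟶
    (TopCat.Presheaf.pushforward _ (isoMSpec A).hom).obj (basisPresheaf A).presheaf :=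
  sheafifyLift _ (modUnitsHom A) pushforward_isSheaf

instance : IsIso (reducedSheafHom A) :=
  isIso_sheafifyLift _
    ((Opens.grothendieckTopology _).W_of_isLocallyBijective (modUnitsHom A)) pushforward_isSheaf

lemma reducedSheafHom_reducedSection (Y : A) :
    (reducedSheafHom A).app (op ⊤) (MSpec.reducedSection (GrothendieckMonoid.mk Y)) =
      sectionsHom ⊤ (MSpec.structureSection _ (GrothendieckMonoid.mk Y)) :=
  ConcreteCategory.congr_hom (NatTrans.congr_app (toSheafify_sheafifyLift _ (modUnitsHom A)
    pushforward_isSheaf) (op ⊤)) _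

end SerreSubcategory

/-! ### The isomorphism of monoidal spaces -/

namespace MonoidalSpace

lemma isLocalAddHom_of_isIso {M N : AddCommMonCat.{u}} (f : M ⟶ N) [IsIso f] :
    IsLocalAddHom f.hom := fun x =>
  ⟨fun h => by simpa using! h.map (inv f).hom, fun h => h.map f.hom⟩

/-- An isomorphism of the underlying presheafed spaces is an isomorphism of monoidal spaces. -/
def isoOfIso {X Y : MonoidalSpace.{u}} (e : X.toPresheafedSpace ≅ Y.toPresheafedSpace) :
    X ≅ Y where
  hom := ⟨e.hom, fun _ => isLocalAddHom_of_isIso _⟩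
  inv := ⟨e.inv, fun _ => isLocalAddHom_of_isIso _⟩
  hom_inv_id := Hom.ext' e.hom_inv_id
  inv_hom_id := Hom.ext' e.inv_hom_id

end MonoidalSpace

namespace SerreSubcategory

/-- The isomorphism of monoidal spaces between Serre subcategories and prime ideals of the
Grothendieck monoid. -/
def monoidalSpaceIso (A : Type u) [Category.{v} A] [Abelian A] :
    monoidalSpace A ≅ MSpec.monoidalSpace (GrothendieckMonoid A) :=
  MonoidalSpace.isoOfIso (PresheafedSpace.isoOfComponents (X := (monoidalSpace A).toPresheafedSpace)
    (Y := (MSpec.monoidalSpace (GrothendieckMonoid A)).toPresheafedSpace) (isoMSpec A)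
    -- `isoOfComponents` expects an isomorphism from the pushforward to the target sheaf and uses
    -- its inverse as the sheaf component of `hom`; with `symm`, that component is `reducedSheafHom
    -- A`.
    (asIso (reducedSheafHom A)).symm)

lemma monoidalSpaceIso_app_reducedSection {A : Type u} [Category.{v} A] [Abelian A] (Y : A) :
    (monoidalSpaceIso A).hom.c.app (op ⊤) (MSpec.reducedSection (GrothendieckMonoid.mk Y)) =
      sectionsHom ⊤ (MSpec.structureSection _ (GrothendieckMonoid.mk Y)) :=
  reducedSheafHom_reducedSection Y

end SerreSubcategory

end

theorem mainTheorem11 {A : Type u} [Category.{v} A] [Abelian A] :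
    Function.Bijective
      (SerreSubcategory.toMSpec : SerreSubcategory A → MSpec (GrothendieckMonoid A)) ∧
    ∃ e : SerreSubcategory.monoidalSpace A ≅ MSpec.monoidalSpace (GrothendieckMonoid A),
      (∀ S : SerreSubcategory A, e.hom.base S = SerreSubcategory.toMSpec S) ∧
      ∀ X Y : A,
        (SerreSubcategory.basisPresheaf A).eval X le_top
            (e.hom.c.app (op ⊤) (MSpec.reducedSection (GrothendieckMonoid.mk Y))) =
          GrothendieckMonoid.mk ((SerreSubcategory.gen X).Q.obj Y) := by
  refine ⟨(SerreSubcategory.equivMSpec A).bijective, SerreSubcategory.monoidalSpaceIso A,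
    fun _ => rfl, fun X Y => ?_⟩
  rw [SerreSubcategory.monoidalSpaceIso_app_reducedSection]
  -- By definition the component at `X` is `locToQuotient X` applied to the image of `[Y]` in
  -- `M(A)_[X]`.
  exact (SerreSubcategory.locToQuotient_toLoc X _).trans (GrothendieckMonoid.map_mk _ Y)
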